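/- Let $\mathbb{T}$ be the Tribonacci sequence, i.e. the fixed point beginning with $a$ of the morphism $\tau$ with $\tau(a)=ab$, $\tau(b)=ac$, $\tau(c)=a$, with positions numbered from $1$, and let $\mathbb{T}[1,n]$ be its prefix of length $n$. Let $\mathcal{P}_T$ be the set of nonempty palindromes occurring in $\mathbb{T}$; for $\omega\in\mathcal{P}_T$ and $p\ge 1$ let $\omega_p$ be the $p$-th occurrence of $\omega$ in $\mathbb{T}$. For $n\ge 1$ let $$b(n)=\sharp\{(\omega,p):\omega\in\mathcal{P}_T,\ p\ge 1,\ \omega_p \text{ ends at position } n \text{ of } \mathbb{T}\}.$$ Let $t_{-2}=0$, $t_{-1}=t_0=1$, $t_m=t_{m-1}+t_{m-2}+t_{m-3}$ for $m\ge 1$, and let $k_0=0$, $k_1=k_2=1$, $k_m=k_{m-1}+k_{m-2}+k_{m-3}-1$ for $m\ge 3$. Put $$D(m)=\frac{m}{22}\left(3t_m+7t_{m-1}+2t_{m-2}\right)+\frac{1}{22}\left(3t_m-3t_{m-1}+4t_{m-2}\right)\quad(m\ge 1),$$ and, for $m\ge 4$, $\alpha_m=k_{m+3}+t_{m-4}$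 and $\beta_m=k_{m+3}+t_{m-4}+t_{m-3}$. Let $n\ge 15$. Then there is exactly one integer $m\ge 0$ with $k_{m+3}\le n+1<k_{m+4}$; it satisfies $m\ge 4$, and $$\sum_{i=k_{m+3}-1}^{n} b(i)=\begin{cases} \displaystyle\sum_{i=k_m-1}^{n-t_{m-1}} b(i)+n-k_{m+3}+2, & n+1<\alpha_m,\\[2ex] \displaystyle\sum_{i=k_{m+1}-1}^{n-t_{m-1}} b(i)+D(m-3)+n-k_{m+3}+2, & \alpha_m\le n+1<\beta_m,\\[2ex] \displaystyle\sum_{i=k_{m+2}-1}^{n-t_{m-1}} b(i)+D(m-3)+D(m-2)+n-k_{m+3}+2, & \beta_m\le n+1. \end{cases}$$ -/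

import Mathlib

namespace TribPal

/-- The three-letter alphabet `{a, b, c}`. -/
inductive Letter : Type
  | a : Letter
  | b : Letter
  | c : Letter
  deriving DecidableEq

/-- The Tribonacci morphism on letters: `a ↦ ab`, `b ↦ ac`, `c ↦ a`. -/
def tau : Letter → List Letter
  | Letter.a => [Letter.a, Letter.b]
  | Letter.b => [Letter.a, Letter.c]
  | Letter.c => [Letter.a]

/-- The finite words `T_m = τ^m(a)`, with `τ` extended to words by concatenation. -/
def word : ℕ → List Letter
  | 0 => [Letter.a]
  | m + 1 => (word m).flatMap tau

/-- `T_m` is a prefix of `T_{m+1}`, so the words `T_m` converge to the fixed point of `τ`. -/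
theorem word_prefix_succ (m : ℕ) : word m <+: word (m + 1) := by
  induction m with
  | zero => exact ⟨[Letter.b], rfl⟩
  | succ m ih =>
    obtain ⟨s, hs⟩ := ih
    refine ⟨s.flatMap tau, ?_⟩
    rw [word, ← List.flatMap_append, hs]
    rfl

theorem length_le_length_flatMap (w : List Letter) : w.length ≤ (w.flatMap tau).length := by
  induction w with
  | nil => simp
  | cons x w ih =>
    have hx : 1 ≤ (tau x).length := by cases x <;> simp [tau]
    rw [List.flatMap_cons, List.length_append, List.length_cons]
    omega

/-- `T_m` has more than `m` letters. -/
theorem lt_length_word (m : ℕ) : m < (word m).length := by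
  have key : ∀ m, ∃ w, word m = Letter.a :: w := by
    intro m
    induction m with
    | zero => exact ⟨[], rfl⟩
    | succ m ih =>
      obtain ⟨w, hw⟩ := ih
      exact ⟨Letter.b :: w.flatMap tau, by simp [word, hw, tau]⟩
  induction m with
  | zero => simp [word]
  | succ m ih =>
    obtain ⟨w, hw⟩ := key m
    have h := length_le_length_flatMap w
    rw [hw] at ih
    simp only [word, hw, List.flatMap_cons, tau, List.length_append, List.length_cons,
      List.length_nil] at ih ⊢
    omega

/-- The Tribonacci sequence, the fixed point of `τ` beginning with `a`. It is indexed from `0`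
here: `tribonacci i` is the letter at position `i + 1`. -/
def tribonacci (i : ℕ) : Letter := (word i)[i]'(lt_length_word i)

/-- The prefix `𝕋[1,n]` of length `n` of the Tribonacci sequence. -/
def tribPrefix (n : ℕ) : List Letter := (List.range n).map tribonacci

/-- The set of (nonempty) palindromes that occur in the Tribonacci sequence. -/
def palindromes : Set (List Letter) :=
  {w | w ≠ [] ∧ w.Palindrome ∧ ∃ n, w <:+ tribPrefix n}

/-- The `p`-th occurrence of `w` in the Tribonacci sequence ends at position `n`: the word `w`
ends at position `n`, and it ends at exactly `p` positions between `1` and `n`. -/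
def OccurrenceEndsAt (w : List Letter) (p n : ℕ) : Prop :=
  w <:+ tribPrefix n ∧ ((Finset.Icc 1 n).filter (fun j => w <:+ tribPrefix j)).card = p

/-- `b(n)`: the number of pairs `(w, p)`, with `w` a palindrome of the Tribonacci sequence and
`p ≥ 1`, such that the `p`-th occurrence of `w` is a suffix of the prefix of length `n`. -/
noncomputable def b (n : ℕ) : ℕ :=
  {x : List Letter × ℕ | x.1 ∈ palindromes ∧ 1 ≤ x.2 ∧ OccurrenceEndsAt x.1 x.2 n}.ncard

/-- The Tribonacci recurrence started at `0, 1, 1`. -/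
def tribAux : ℕ → ℕ
  | 0 => 0
  | 1 => 1
  | 2 => 1
  | j + 3 => tribAux (j + 2) + tribAux (j + 1) + tribAux j

/-- The Tribonacci numbers `t_m`, `m ≥ -2`: `t_{-2} = 0`, `t_{-1} = t_0 = 1` and
`t_m = t_{m-1} + t_{m-2} + t_{m-3}` for `m ≥ 1`. -/
def t (m : ℤ) : ℕ := tribAux (m + 2).toNat

/-- The kernel numbers: `k_0 = 0`, `k_1 = k_2 = 1`, `k_m = k_{m-1} + k_{m-2} + k_{m-3} - 1` for
`m ≥ 3`. The subtraction never truncates, since `k_j ≥ 1` for `j ≥ 1`. -/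
def k : ℕ → ℕ
  | 0 => 0
  | 1 => 1
  | 2 => 1
  | j + 3 => k (j + 2) + k (j + 1) + k j - 1

/-- `D(m) = m/22 (3 t_m + 7 t_{m-1} + 2 t_{m-2}) + 1/22 (3 t_m - 3 t_{m-1} + 4 t_{m-2})`. -/
def D (m : ℤ) : ℚ :=
  (m : ℚ) / 22 * (3 * (t m : ℚ) + 7 * (t (m - 1) : ℚ) + 2 * (t (m - 2) : ℚ))
    + 1 / 22 * (3 * (t m : ℚ) - 3 * (t (m - 1) : ℚ) + 4 * (t (m - 2) : ℚ))

/-- `α_m = k_{m+3} + t_{m-4}`. -/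
def α (m : ℕ) : ℕ := k (m + 3) + t ((m : ℤ) - 4)

/-- `β_m = k_{m+3} + t_{m-4} + t_{m-3}`. -/
def β (m : ℕ) : ℕ := k (m + 3) + t ((m : ℤ) - 4) + t ((m : ℤ) - 3)

end TribPal

namespace TribPal

/-! ### Palindromic prefixes of the Tribonacci sequence -/

/-! The lengths `palLen j` of the palindromic prefixes satisfy `k (j + 4) = palLen j + 2`, so the
kernel numbers cut the positions into the blocks `(palLen j, palLen (j + 1)]`, of length `t_j`. Take
`n = i + t_j` in such a block. Reflecting in the palindromic prefixes of lengths `palLen (j + 1)`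
and `palLen j` in turn translates by `t_j`, so the palindromes ending at `n` and starting at or
after `t_j` (from `0`) match those ending at `i`. Exactly one starts earlier, namely the one
concentric with the prefix of length `palLen (j + 1)` (`PalAt.add_eq_palLen`). Hence `b n = b i + 1`
(`b_add_tribAux`). Summing gives the first formula. It also gives a recurrence for whole-block sums,
which `D` solves (`sum_b_eq_D`); splitting off one or two whole blocks gives the other two formulas.
-/

/-- The lengths of the palindromic prefixes of the Tribonacci sequence. -/
def palLen : ℕ → ℕ
  | 0 => 0
  | j + 1 => palLen j + tribAux (j + 2)

/-- The palindromic prefixes `T_{j-1} T_{j-2} ⋯ T_0` of the Tribonacci sequence. -/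
def palPrefix : ℕ → List Letter
  | 0 => []
  | j + 1 => word j ++ palPrefix j

/-- The cyclic successor of a letter. -/
def nextLetter : Letter → Letter
  | Letter.a => Letter.b
  | Letter.b => Letter.c
  | Letter.c => Letter.a

/-- The letter which follows the `j`-th palindromic prefix. -/
def afterPal : ℕ → Letter
  | 0 => Letter.a
  | j + 1 => nextLetter (afterPal j)

/-- The second letter after a palindromic prefix, in terms of the first one. -/
def secondAfter : Letter → Letter
  | Letter.a => Letter.b
  | Letter.b => Letter.a
  | Letter.c => Letter.a

theorem word_add_three (m : ℕ) : word (m + 3) = word (m + 2) ++ word (m + 1) ++ word m := by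
  induction m with
  | zero => rfl
  | succ m ih =>
    conv_lhs => rw [word, ih, List.flatMap_append, List.flatMap_append]
    rfl

theorem length_word : ∀ m : ℕ, (word m).length = tribAux (m + 2)
  | 0 => rfl
  | 1 => rfl
  | 2 => rfl
  | m + 3 => by
    rw [word_add_three, List.length_append, List.length_append, length_word m,
      length_word (m + 1), length_word (m + 2)]
    rfl

theorem length_palPrefix (j : ℕ) : (palPrefix j).length = palLen j := by
  induction j with
  | zero => rfl
  | succ j ih => rw [palPrefix, palLen, List.length_append, ih, length_word, add_comm]

theorem palPrefix_succ (j : ℕ) : palPrefix (j + 1) = (palPrefix j).flatMap tau ++ [Letter.a] := by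
  induction j with
  | zero => rfl
  | succ j ih =>
    conv_lhs => rw [palPrefix, ih]
    rw [palPrefix, List.flatMap_append, List.append_assoc]
    rfl

/-- Letter by letter, `τ(x) a = a · reverse (τ(x))`. So `w ↦ τ(w) a` commutes with reversal and
sends palindromes to palindromes. -/
theorem flatMap_tau_append (w : List Letter) :
    w.flatMap tau ++ [Letter.a] = Letter.a :: w.flatMap (fun x => (tau x).reverse) := by
  induction w with
  | nil => rfl
  | cons x w ih =>
    rw [List.flatMap_cons, List.flatMap_cons, List.append_assoc, ih]
    cases x <;> rfl

theorem reverse_flatMap_tau (w : List Letter) :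
    (w.flatMap tau ++ [Letter.a]).reverse = w.reverse.flatMap tau ++ [Letter.a] := by
  rw [flatMap_tau_append w.reverse, List.reverse_append, List.reverse_flatMap]
  rfl

theorem reverse_palPrefix (j : ℕ) : (palPrefix j).reverse = palPrefix j := by
  induction j with
  | zero => rfl
  | succ j ih => rw [palPrefix_succ, reverse_flatMap_tau, ih]

/-- The second letter is carried for the induction: `τ(c) = a` is used up by the new palindromic
prefix, so the letter after it comes from the image of the second letter. -/
theorem exists_word_eq (j : ℕ) : ∃ N r,
    word N = palPrefix j ++ afterPal j :: secondAfter (afterPal j) :: r := by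
  induction j with
  | zero => exact ⟨1, [], rfl⟩
  | succ j ih =>
    obtain ⟨N, r, h⟩ := ih
    refine ⟨N + 1, ?_⟩
    rw [word, h, palPrefix_succ, afterPal]
    cases afterPal j
    · exact ⟨Letter.c :: r.flatMap tau, by simp [tau, nextLetter, secondAfter]⟩
    · exact ⟨Letter.b :: r.flatMap tau, by simp [tau, nextLetter, secondAfter]⟩
    · exact ⟨r.flatMap tau, by simp [tau, nextLetter, secondAfter]⟩

theorem word_prefix_of_le {m n : ℕ} (h : m ≤ n) : word m <+: word n := by
  induction n, h using Nat.le_induction with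
  | base => exact List.prefix_rfl
  | succ n _ ih => exact ih.trans (word_prefix_succ n)

theorem getElem_word (N i : ℕ) (h : i < (word N).length) : (word N)[i] = tribonacci i := by
  rw [tribonacci]
  rcases le_total N i with hN | hN
  · exact (word_prefix_of_le hN).getElem h
  · exact ((word_prefix_of_le hN).getElem (lt_length_word i)).symm

theorem getElem_of_prefix {w : List Letter} {N : ℕ} (hw : w <+: word N) (i : ℕ)
    (h : i < w.length) : w[i] = tribonacci i := by
  rw [hw.getElem h, getElem_word]

theorem tribonacci_palLen (j : ℕ) : tribonacci (palLen j) = afterPal j := by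
  obtain ⟨N, r, h⟩ := exists_word_eq j
  have hp : palPrefix j ++ [afterPal j] <+: word N := ⟨secondAfter (afterPal j) :: r, by simp [h]⟩
  rw [← getElem_of_prefix hp (palLen j) (by simp [length_palPrefix])]
  simp [← length_palPrefix]

/-- The letters at (`0`-based) positions `r, …, s - 1` form a palindrome. -/
def PalAt (r s : ℕ) : Prop :=
  ∀ i j, r ≤ i → r ≤ j → i + j + 1 = r + s → tribonacci i = tribonacci j

theorem palAt_palLen (j : ℕ) : PalAt 0 (palLen j) := by
  obtain ⟨N, r, h⟩ := exists_word_eq j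
  have hp : palPrefix j <+: word N := ⟨_, h.symm⟩
  intro x y _ _ hxy
  have hlen := length_palPrefix j
  have hx : x < (palPrefix j).length := by omega
  have hy : y < (palPrefix j).length := by omega
  rw [← getElem_of_prefix hp x hx, ← getElem_of_prefix hp y hy]
  have hr : (palPrefix j).reverse[x]'(by simpa using hx) = (palPrefix j)[x] := by
    simp only [reverse_palPrefix]
  rw [← hr, List.getElem_reverse]
  congr 1
  omega

theorem PalAt.shrink {r s r' s' : ℕ} (h : PalAt r s) (hr : r ≤ r') (he : r' + s' = r + s) :
    PalAt r' s' :=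
  fun i j hi hj hij => h i j (hr.trans hi) (hr.trans hj) (hij.trans he)

/-- The map `x ↦ l - 1 - x` preserves letters on a palindromic prefix of length `l`. -/
theorem PalAt.reflect {r s r' s' l : ℕ} (h : PalAt r s) (hl : PalAt 0 l) (hr : r + s' = l)
    (hs : s + r' = l) : PalAt r' s' := by
  intro i j hi hj hij
  rcases Nat.lt_or_ge i l with hil | hil
  · rcases Nat.lt_or_ge j l with hjl | hjl
    · rw [hl i (l - 1 - i) (Nat.zero_le _) (Nat.zero_le _) (by omega),
        hl j (l - 1 - j) (Nat.zero_le _) (Nat.zero_le _) (by omega)]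
      exact h _ _ (by omega) (by omega) (by omega)
    · omega
  · omega

theorem palLen_add_three (j : ℕ) : palLen (j + 3) = palLen j + tribAux (j + 5) := by
  simp only [palLen, tribAux]
  ring

theorem palLen_mono : Monotone palLen :=
  monotone_nat_of_le_succ fun j => by rw [palLen]; omega

theorem tribAux_le_palLen : ∀ j : ℕ, tribAux (j + 2) ≤ palLen j + 1
  | 0 => by decide
  | 1 => by decide
  | 2 => by decide
  | j + 3 => by
    change tribAux (j + 5) ≤ _
    rw [palLen_add_three]
    omega

theorem afterPal_ne {i j : ℕ} (hij : i < j) (hj : j < i + 3) : afterPal i ≠ afterPal j := by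
  obtain rfl | rfl : j = i + 1 ∨ j = i + 2 := by omega
  · rw [afterPal]; cases afterPal i <;> simp [nextLetter]
  · rw [afterPal, afterPal]; cases afterPal i <;> simp [nextLetter]

theorem not_palAt_of_add_lt {j : ℕ} (hB : ∀ r, r + 1 < tribAux (j + 2) → ¬PalAt r (palLen j + 1))
    {r s : ℕ} (hs : palLen j < s) (hrs : r + s < palLen (j + 1)) : ¬PalAt r s := by
  intro h
  rw [palLen] at hrs
  exact hB (r + s - palLen j - 1) (by omega) (h.shrink (by omega) (by omega))

/-- The two claims are proved together: the second at `j` gives the first at `j` (`key`), and the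
first at `j` gives the second at `j + 1` by shrinking a prefix of intermediate length about its
centre. -/
theorem not_palAt_palLen_add_one_and (j : ℕ) :
    (∀ r, r + 1 < tribAux (j + 2) → ¬PalAt r (palLen j + 1)) ∧
      ∀ q, q ≤ palLen j → PalAt 0 q → ∃ i ≤ j, q = palLen i := by
  have key : ∀ j, (∀ q, q ≤ palLen j → PalAt 0 q → ∃ i ≤ j, q = palLen i) →
      ∀ r, r + 1 < tribAux (j + 2) → ¬PalAt r (palLen j + 1) := by
    intro j hC r hr h
    have hle := tribAux_le_palLen j
    have hl := palAt_palLen j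
    have h1 : tribonacci (palLen j - 1 - r) = tribonacci (palLen j) := by
      rw [hl (palLen j - 1 - r) r (Nat.zero_le _) (Nat.zero_le _) (by omega)]
      exact h r (palLen j) le_rfl (by omega) (by omega)
    -- Removing both end letters leaves a palindromic suffix of the `j`-th palindromic prefix; its
    -- mirror image is a palindromic prefix.
    have h2 : PalAt 0 (palLen j - 1 - r) :=
      PalAt.reflect (h.shrink (Nat.le_succ r) (s' := palLen j) (by omega)) hl (by omega)
        (by omega)
    obtain ⟨i, hij, hi⟩ := hC _ (by omega) h2
    rw [hi, tribonacci_palLen, tribonacci_palLen] at h1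
    have hlt : i < j := lt_of_le_of_ne hij (by rintro rfl; omega)
    by_cases h3 : j < i + 3
    -- The letters after the palindromic prefixes have period 3, so equal letters force `i ≤ j - 3`;
    -- the prefix is then too short for the bound on `r`.
    · exact afterPal_ne hlt h3 h1
    · obtain ⟨d, rfl⟩ : ∃ d, j = d + 3 := ⟨j - 3, by omega⟩
      have := palLen_mono (show i ≤ d by omega)
      rw [palLen_add_three] at hi
      change r + 1 < tribAux (d + 5) at hr
      omega
  induction j with
  | zero =>
    refine ⟨fun r hr => ?_, fun q hq _ => ⟨0, le_rfl, by simpa [palLen] using hq⟩⟩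
    simp [tribAux] at hr
  | succ j ih =>
    have hC : ∀ q, q ≤ palLen (j + 1) → PalAt 0 q → ∃ i ≤ j + 1, q = palLen i := by
      intro q hq h
      rcases le_or_gt q (palLen j) with h1 | h1
      · obtain ⟨i, hi, h⟩ := ih.2 q h1 h
        exact ⟨i, by omega, h⟩
      · rcases hq.lt_or_eq with h2 | h2
        · exact absurd h (not_palAt_of_add_lt ih.1 h1 (by omega))
        · exact ⟨j + 1, le_rfl, h2⟩
    exact ⟨key (j + 1) hC, hC⟩

/-- A centre too far left is excluded by shrinking; one too far right becomes too far left after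
reflection in the prefix of length `palLen (j + 1)`. -/
theorem PalAt.add_eq_palLen {j r s : ℕ} (h : PalAt r s) (hs : palLen j < s)
    (hs' : s ≤ palLen (j + 1)) (hr : r < tribAux (j + 2)) : r + s = palLen (j + 1) := by
  have hB := (not_palAt_palLen_add_one_and j).1
  have hl : palLen (j + 1) = palLen j + tribAux (j + 2) := rfl
  rcases lt_trichotomy (r + s) (palLen (j + 1)) with h1 | h1 | h1
  · exact absurd h (not_palAt_of_add_lt hB hs h1)
  · exact h1
  · have h2 : PalAt (palLen (j + 1) - s) (palLen (j + 1) - r) :=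
      h.reflect (palAt_palLen (j + 1)) (by omega) (by omega)
    exact absurd h2 (not_palAt_of_add_lt hB (by omega) (by omega))

/-! ### Counting palindromic suffixes -/

theorem length_tribPrefix (n : ℕ) : (tribPrefix n).length = n := by simp [tribPrefix]

theorem palindrome_drop_iff (n r : ℕ) : ((tribPrefix n).drop r).Palindrome ↔ PalAt r n := by
  rw [List.Palindrome.iff_reverse_eq]
  constructor
  · intro h i j hi hj hij
    have h1 : ((tribPrefix n).drop r).reverse[i - r]'(by simp [tribPrefix]; omega) =
        ((tribPrefix n).drop r)[i - r]'(by simp [tribPrefix]; omega) := by simp only [h]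
    simp only [tribPrefix, List.getElem_reverse, List.getElem_drop, List.getElem_map,
      List.getElem_range, List.length_drop, List.length_map, List.length_range] at h1
    rw [show r + (i - r) = i by omega, show r + (n - r - 1 - (i - r)) = j by omega] at h1
    exact h1.symm
  · intro h
    apply List.ext_getElem (by simp)
    intro i h1 h2
    simp only [tribPrefix, List.getElem_reverse, List.getElem_drop, List.getElem_map,
      List.getElem_range, List.length_drop, List.length_map, List.length_range] at h1 h2 ⊢
    exact h _ _ (by omega) (by omega) (by omega)

open Classical in
-- Once `n` is fixed, `p` is determined by the word, and the word by its starting position.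
theorem b_eq_card (n : ℕ) : b n = ((Finset.range n).filter fun r => PalAt r n).card := by
  have himg : {x : List Letter × ℕ | x.1 ∈ palindromes ∧ 1 ≤ x.2 ∧ OccurrenceEndsAt x.1 x.2 n} =
      (fun r => ((tribPrefix n).drop r, ((Finset.Icc 1 n).filter
        (fun j => (tribPrefix n).drop r <:+ tribPrefix j)).card)) ''
        (((Finset.range n).filter fun r => PalAt r n : Finset ℕ) : Set ℕ) := by
    ext ⟨w, p⟩
    simp only [Set.mem_ofPred_eq, Set.mem_image, Finset.coe_filter, Finset.mem_range,
      Prod.mk.injEq]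
    constructor
    · rintro ⟨⟨hne, hpal, -⟩, -, hsuf, hcard⟩
      have hle := hsuf.length_le
      have hw := List.length_pos_iff.2 hne
      rw [length_tribPrefix] at hle
      have hdrop : (tribPrefix n).drop (n - w.length) = w := by
        have := List.suffix_iff_eq_drop.1 hsuf
        rw [length_tribPrefix] at this
        exact this.symm
      refine ⟨n - w.length, ⟨by omega, ?_⟩, hdrop, ?_⟩
      · rw [← palindrome_drop_iff, hdrop]
        exact hpal
      · rw [hdrop, ← hcard]
    · rintro ⟨r, ⟨hr, hpal⟩, rfl, rfl⟩
      have hsuf : (tribPrefix n).drop r <:+ tribPrefix n := List.drop_suffix _ _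
      refine ⟨⟨?_, (palindrome_drop_iff n r).2 hpal, n, hsuf⟩, ?_, hsuf, ?_⟩
      · rw [← List.length_pos_iff, List.length_drop, length_tribPrefix]
        omega
      · exact Finset.card_pos.2 ⟨n, by simpa using ⟨by omega, hsuf⟩⟩
      · congr
  rw [b, himg, Set.InjOn.ncard_image, Set.ncard_coe_finset]
  intro r hr r' hr' h
  have := congrArg (fun x => x.1.length) h
  simp only [Finset.coe_filter, Finset.mem_range, Set.mem_ofPred_eq, List.length_drop,
    length_tribPrefix] at this hr hr'
  omega

theorem palAt_add_iff {j r i : ℕ} (hi : i + tribAux (j + 2) ≤ palLen (j + 1)) (hr : r ≤ i) :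
    PalAt (r + tribAux (j + 2)) (i + tribAux (j + 2)) ↔ PalAt r i := by
  rw [palLen] at hi
  have hl : palLen (j + 1) = palLen j + tribAux (j + 2) := rfl
  constructor <;> intro h
  · have h1 : PalAt (palLen j - i) (palLen j - r) :=
      h.reflect (palAt_palLen (j + 1)) (by omega) (by omega)
    exact h1.reflect (palAt_palLen j) (by omega) (by omega)
  · have h1 : PalAt (palLen j - i) (palLen j - r) :=
      h.reflect (palAt_palLen j) (by omega) (by omega)
    exact h1.reflect (palAt_palLen (j + 1)) (by omega) (by omega)

theorem b_add_tribAux {j i : ℕ} (hi : palLen j < i + tribAux (j + 2))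
    (hi' : i + tribAux (j + 2) ≤ palLen (j + 1)) : b (i + tribAux (j + 2)) = b i + 1 := by
  classical
  have hle := tribAux_le_palLen j
  have hl : palLen (j + 1) = palLen j + tribAux (j + 2) := rfl
  have hset : ((Finset.range (i + tribAux (j + 2))).filter
      fun r => PalAt r (i + tribAux (j + 2))) =
      insert (palLen j - i) (((Finset.range i).filter fun r => PalAt r i).map
        (addRightEmbedding (tribAux (j + 2)))) := by
    ext r
    simp only [Finset.mem_filter, Finset.mem_range, Finset.mem_insert, Finset.mem_map,
      addRightEmbedding_apply]
    constructor
    · rintro ⟨hr, h⟩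
      rcases Nat.lt_or_ge r (tribAux (j + 2)) with h1 | h1
      · have := h.add_eq_palLen hi hi' h1
        exact Or.inl (by omega)
      · refine Or.inr ⟨r - tribAux (j + 2), ⟨by omega, ?_⟩, by omega⟩
        rw [← palAt_add_iff hi' (by omega), Nat.sub_add_cancel h1]
        exact h
    · rintro (rfl | ⟨r, ⟨hr, h⟩, rfl⟩)
      · exact ⟨by omega, (palAt_palLen (j + 1)).shrink (Nat.zero_le _) (by omega)⟩
      · exact ⟨by omega, (palAt_add_iff hi' hr.le).2 h⟩
  rw [b_eq_card, b_eq_card, hset, Finset.card_insert_of_notMem, Finset.card_map]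
  simp only [Finset.mem_map, Finset.mem_filter, Finset.mem_range, addRightEmbedding_apply,
    not_exists, not_and]
  intro r _
  omega

/-! ### Sums over blocks -/

theorem sum_b_shift {j c d : ℕ} (hc : palLen j < c + tribAux (j + 2))
    (hd : d + tribAux (j + 2) ≤ palLen (j + 1) + 1) :
    ∑ i ∈ Finset.Ico (c + tribAux (j + 2)) (d + tribAux (j + 2)), b i =
      ∑ i ∈ Finset.Ico c d, b i + (d - c) := by
  rw [← Finset.sum_Ico_add', Finset.sum_congr rfl (g := fun i => b i + 1),
    Finset.sum_add_distrib]
  · simp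
  · intro i hi
    rw [Finset.mem_Ico] at hi
    exact b_add_tribAux (by omega) (by omega)

/-- Since `palLen (j + 3) = palLen j + t_{j+3}`, translating back by `t_{j+3}` carries this block
onto the union of the three preceding ones. -/
theorem sum_b_block (j : ℕ) :
    ∑ i ∈ Finset.Ico (palLen (j + 3) + 1) (palLen (j + 4) + 1), b i =
      ∑ i ∈ Finset.Ico (palLen j + 1) (palLen (j + 1) + 1), b i +
      ∑ i ∈ Finset.Ico (palLen (j + 1) + 1) (palLen (j + 2) + 1), b i +
      ∑ i ∈ Finset.Ico (palLen (j + 2) + 1) (palLen (j + 3) + 1), b i + tribAux (j + 5) := by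
  have h3 := palLen_add_three j
  have h4 : palLen (j + 4) = palLen (j + 3) + tribAux (j + 5) := rfl
  have h : ∑ i ∈ Finset.Ico (palLen j + 1 + tribAux (j + 5)) (palLen (j + 3) + 1 + tribAux (j + 5)),
      b i = ∑ i ∈ Finset.Ico (palLen j + 1) (palLen (j + 3) + 1), b i +
        (palLen (j + 3) + 1 - (palLen j + 1)) :=
    sum_b_shift (j := j + 3) (show palLen (j + 3) < palLen j + 1 + tribAux (j + 5) by omega)
      (show palLen (j + 3) + 1 + tribAux (j + 5) ≤ palLen (j + 4) + 1 by omega)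
  rw [show palLen j + 1 + tribAux (j + 5) = palLen (j + 3) + 1 by omega,
    show palLen (j + 3) + 1 + tribAux (j + 5) = palLen (j + 4) + 1 by omega,
    show palLen (j + 3) + 1 - (palLen j + 1) = tribAux (j + 5) by omega] at h
  rw [h, Finset.sum_Ico_consecutive _ (Nat.succ_le_succ (palLen_mono (Nat.le_succ _)))
    (Nat.succ_le_succ (palLen_mono (Nat.le_succ _))), Finset.sum_Ico_consecutive _
    (Nat.succ_le_succ (palLen_mono (by omega))) (Nat.succ_le_succ (palLen_mono (Nat.le_succ _)))]

theorem t_sub_two (n : ℕ) : t ((n : ℤ) - 2) = tribAux n := by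
  simp [t]

theorem D_add_one (j : ℕ) : D ((j : ℤ) + 1) =
    ((j : ℚ) + 1) / 22 * (3 * tribAux (j + 3) + 7 * tribAux (j + 2) + 2 * tribAux (j + 1)) +
      1 / 22 * (3 * tribAux (j + 3) - 3 * tribAux (j + 2) + 4 * tribAux (j + 1)) := by
  rw [D, ← t_sub_two, ← t_sub_two, ← t_sub_two]
  have h1 : (j : ℤ) + 1 = ((j + 3 : ℕ) : ℤ) - 2 := by push_cast; ring
  have h2 : (j : ℤ) + 1 - 1 = ((j + 2 : ℕ) : ℤ) - 2 := by push_cast; ring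
  have h3 : (j : ℤ) + 1 - 2 = ((j + 1 : ℕ) : ℤ) - 2 := by push_cast; ring
  rw [← h1, ← h2, ← h3]
  push_cast
  rfl

theorem b_zero : b 0 = 0 := by
  classical
  simp [b_eq_card]

theorem b_one : b 1 = 1 := by
  have := b_add_tribAux (j := 0) (i := 0) (by decide) (by decide)
  rwa [b_zero] at this

theorem b_two : b 2 = 1 := by
  have := b_add_tribAux (j := 1) (i := 0) (by decide) (by decide)
  rwa [b_zero] at this

theorem b_three : b 3 = 2 := by
  have := b_add_tribAux (j := 1) (i := 1) (by decide) (by decide)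
  rwa [b_one] at this

theorem sum_b_eq_D : ∀ j : ℕ,
    ((∑ i ∈ Finset.Ico (palLen j + 1) (palLen (j + 1) + 1), b i : ℕ) : ℚ) = D ((j : ℤ) + 1)
  | 0 => by
    rw [D_add_one]
    norm_num [palLen, tribAux, b_one]
  | 1 => by
    rw [D_add_one]
    norm_num [palLen, tribAux, Finset.sum_Ico_succ_top, b_two, b_three]
  | 2 => by
    have h := sum_b_shift (j := 2) (c := 0) (d := 4) (by decide) (by decide)
    rw [D_add_one, show palLen 2 + 1 = 0 + tribAux (2 + 2) from rfl,
      show palLen (2 + 1) + 1 = 4 + tribAux (2 + 2) from rfl, h]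
    norm_num [tribAux, Finset.sum_Ico_succ_top, Finset.sum_range_succ, b_zero,
      b_one, b_two, b_three]
  | j + 3 => by
    have h0 := sum_b_eq_D j
    have h1 := sum_b_eq_D (j + 1)
    have h2 := sum_b_eq_D (j + 2)
    rw [sum_b_block, Nat.cast_add, Nat.cast_add, Nat.cast_add, h0, h1, h2]
    simp only [D_add_one, tribAux]
    push_cast
    ring

/-! ### Kernel numbers -/

theorem palLen_eq_add : ∀ j : ℕ,
    palLen (j + 3) = palLen (j + 2) + palLen (j + 1) + palLen j + 3
  | 0 => rfl
  | j + 1 => by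
    have h := palLen_eq_add j
    have e : ∀ i, palLen (i + 1) = palLen i + tribAux (i + 2) := fun _ => rfl
    have e3 : tribAux (j + 5) = tribAux (j + 4) + tribAux (j + 3) + tribAux (j + 2) := rfl
    have h0 := e j
    have h1 := e (j + 1)
    have h2 := e (j + 2)
    have h3 := e (j + 3)
    simp only [add_assoc, Nat.reduceAdd] at *
    omega

theorem k_add_four : ∀ j : ℕ, k (j + 4) = palLen j + 2
  | 0 => rfl
  | 1 => rfl
  | 2 => rfl
  | j + 3 => by
    rw [palLen_eq_add]
    change k (j + 2 + 4) + k (j + 1 + 4) + k (j + 4) - 1 = _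
    rw [k_add_four j, k_add_four (j + 1), k_add_four (j + 2)]
    omega

/-- The index starts at 3 because `k 1 = k 2 = k 3`. -/
theorem k_strictMono : StrictMono fun m => k (m + 3) := by
  refine strictMono_nat_of_lt_succ fun m => ?_
  cases m with
  | zero => decide
  | succ j =>
    change k (j + 4) < k (j + 1 + 4)
    rw [k_add_four, k_add_four, palLen, ← length_word]
    have := lt_length_word j
    omega

theorem existsUnique_k_le (n : ℕ) : ∃! m : ℕ, k (m + 3) ≤ n + 1 ∧ n + 1 < k (m + 4) := by
  classical
  have hex : ∃ m, n + 1 < k (m + 3) := ⟨n + 2, k_strictMono.le_apply⟩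
  obtain ⟨m, hm⟩ : ∃ m, Nat.find hex = m + 1 := by
    refine Nat.exists_eq_succ_of_ne_zero fun h => ?_
    have := Nat.find_spec hex
    rw [h] at this
    simp [k] at this
  have hs := Nat.find_spec hex
  rw [hm] at hs
  have hlt := Nat.find_min hex (m := m) (by omega)
  refine ⟨m, ⟨by omega, hs⟩, fun m' ⟨h1, h2⟩ => ?_⟩
  have h3 : m' < m + 1 := k_strictMono.lt_iff_lt.1 (lt_of_le_of_lt h1 hs)
  have h4 : m < m' + 1 := k_strictMono.lt_iff_lt.1 (lt_of_le_of_lt (not_lt.1 hlt) h2)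
  omega

end TribPal

theorem mainTheorem6 (n : ℕ) (hn : 15 ≤ n) :
    (∃! m : ℕ, TribPal.k (m + 3) ≤ n + 1 ∧ n + 1 < TribPal.k (m + 4)) ∧
    ∀ m : ℕ, TribPal.k (m + 3) ≤ n + 1 → n + 1 < TribPal.k (m + 4) →
      4 ≤ m ∧
      (n + 1 < TribPal.α m →
        ∑ i ∈ Finset.Icc (TribPal.k (m + 3) - 1) n, (TribPal.b i : ℚ) =
          (∑ i ∈ Finset.Icc (TribPal.k m - 1) (n - TribPal.t ((m : ℤ) - 1)),
              (TribPal.b i : ℚ))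
            + (n : ℚ) - TribPal.k (m + 3) + 2) ∧
      (TribPal.α m ≤ n + 1 → n + 1 < TribPal.β m →
        ∑ i ∈ Finset.Icc (TribPal.k (m + 3) - 1) n, (TribPal.b i : ℚ) =
          (∑ i ∈ Finset.Icc (TribPal.k (m + 1) - 1) (n - TribPal.t ((m : ℤ) - 1)),
              (TribPal.b i : ℚ))
            + TribPal.D ((m : ℤ) - 3) + (n : ℚ) - TribPal.k (m + 3) + 2) ∧
      (TribPal.β m ≤ n + 1 →
        ∑ i ∈ Finset.Icc (TribPal.k (m + 3) - 1) n, (TribPal.b i : ℚ) =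
          (∑ i ∈ Finset.Icc (TribPal.k (m + 2) - 1) (n - TribPal.t ((m : ℤ) - 1)),
              (TribPal.b i : ℚ))
            + TribPal.D ((m : ℤ) - 3) + TribPal.D ((m : ℤ) - 2)
            + (n : ℚ) - TribPal.k (m + 3) + 2) := by
  open TribPal in
  refine ⟨existsUnique_k_le n, fun m hm hm' => ?_⟩
  have h4 : 4 ≤ m := by
    by_contra h
    have h1 : k (m + 4) ≤ k (4 + 3) := k_strictMono.monotone (show m + 1 ≤ 4 by omega)
    have h2 : k (4 + 3) = 9 := rfl
    omega
  obtain ⟨j, rfl⟩ : ∃ j, m = j + 4 := ⟨m - 4, by omega⟩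
  have hk0 := k_add_four j
  have hk1 : k (j + 4 + 1) = palLen (j + 1) + 2 := k_add_four (j + 1)
  have hk2 : k (j + 4 + 2) = palLen (j + 2) + 2 := k_add_four (j + 2)
  have hk3 : k (j + 4 + 3) = palLen (j + 3) + 2 := k_add_four (j + 3)
  have hk4 : k (j + 4 + 4) = palLen (j + 4) + 2 := k_add_four (j + 4)
  have hl3 := palLen_add_three j
  have hl4 : palLen (j + 4) = palLen (j + 3) + tribAux (j + 5) := rfl
  have hl1 : palLen (j + 1) = palLen j + tribAux (j + 2) := rfl
  have hl2 : palLen (j + 2) = palLen (j + 1) + tribAux (j + 3) := rfl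
  have ht : t (((j + 4 : ℕ) : ℤ) - 1) = tribAux (j + 5) := by
    rw [← t_sub_two]; congr 1; push_cast; ring
  have htα : t (((j + 4 : ℕ) : ℤ) - 4) = tribAux (j + 2) := by
    rw [← t_sub_two]; congr 1; push_cast; ring
  have htβ : t (((j + 4 : ℕ) : ℤ) - 3) = tribAux (j + 3) := by
    rw [← t_sub_two]; congr 1; push_cast; ring
  have hD3 : D (((j + 4 : ℕ) : ℤ) - 3) = D ((j : ℤ) + 1) := by
    congr 1; push_cast; ring
  have hD2 : D (((j + 4 : ℕ) : ℤ) - 2) = D (((j + 1 : ℕ) : ℤ) + 1) := by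
    congr 1; push_cast; ring
  have hα : α (j + 4) = palLen (j + 1) + tribAux (j + 5) + 2 := by
    rw [α, htα]; omega
  have hβ : β (j + 4) = palLen (j + 2) + tribAux (j + 5) + 2 := by
    rw [β, htα, htβ]; omega
  rw [hk3] at hm
  rw [hk4] at hm'
  rw [ht, hD3, hD2, hα, hβ, hk3, hk2, hk1, hk0, ← sum_b_eq_D, ← sum_b_eq_D]
  obtain ⟨d, rfl⟩ : ∃ d, n = d + tribAux (j + 5) := ⟨n - tribAux (j + 5), by omega⟩
  -- The whole range lies in the block ending at `palLen (j + 4)`, and its left end moves to the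
  -- start of the block after `palLen j`.
  have hsum : ∑ i ∈ Finset.Ico (palLen j + 1 + tribAux (j + 5)) (d + 1 + tribAux (j + 5)), b i =
      ∑ i ∈ Finset.Ico (palLen j + 1) (d + 1), b i + (d + 1 - (palLen j + 1)) :=
    sum_b_shift (j := j + 3) (show palLen (j + 3) < palLen j + 1 + tribAux (j + 5) by omega)
      (show d + 1 + tribAux (j + 5) ≤ palLen (j + 4) + 1 by omega)
  rw [show palLen j + 1 + tribAux (j + 5) = palLen (j + 3) + 1 by omega,
    show d + 1 + tribAux (j + 5) = d + tribAux (j + 5) + 1 by omega] at hsum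
  have hcast : ((d + 1 - (palLen j + 1) : ℕ) : ℚ) =
      ((d + tribAux (j + 5) : ℕ) : ℚ) - ((palLen (j + 3) + 2 : ℕ) : ℚ) + 2 := by
    rw [Nat.cast_sub (by omega), hl3]
    push_cast
    ring
  have hs : ∀ l, l + 2 - 1 = l + 1 := fun _ => rfl
  simp only [hs, Nat.add_sub_cancel, ← Nat.cast_sum, ← Finset.Ico_add_one_right_eq_Icc]
  rw [hsum, Nat.cast_add, hcast]
  -- The first formula is the shifted sum itself; the thresholds `α` and `β` ensure that `d` lies
  -- beyond the whole blocks to be split off.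
  refine ⟨h4, fun _ => by ring, fun h _ => ?_, fun h => ?_⟩
  · rw [← Finset.sum_Ico_consecutive b (m := palLen j + 1) (n := palLen (j + 1) + 1)
      (by omega) (by omega), Nat.cast_add]
    ring
  · rw [← Finset.sum_Ico_consecutive b (m := palLen j + 1) (n := palLen (j + 1) + 1)
      (by omega) (by omega), ← Finset.sum_Ico_consecutive b (m := palLen (j + 1) + 1)
      (n := palLen (j + 2) + 1) (by omega) (by omega), Nat.cast_add, Nat.cast_add]
    ring
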